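/- Let $\mathbb{F}$ be an arbitrary field, $n$ a non-negative integer, $M_n(\mathbb{F})$ the vector space of $n\times n$ matrices over $\mathbb{F}$, $\mathfrak{S}_n$ the group of permutations of $\{1,\dots,n\}$ and $\mathbb{F}^*=\mathbb{F}\setminus\{0\}$. Definitions. For $f:\mathfrak{S}_n\to\mathbb{F}^*$, its Schur functional is $$\widetilde f(M)=\sum_{\sigma\in\mathfrak{S}_n} f(\sigma)\prod_{j=1}^n m_{\sigma(j),j}\qquad (M=(m_{i,j})\in M_n(\mathbb{F})),$$ and its transpose is $f^T:\sigma\mapsto f(\sigma^{-1})$. For $f,g:\mathfrak{S}_n\to\mathbb{F}^*$, an $(f,g)$-transformation is a linear endomorphism $U$ of $M_n(\mathbb{F})$ such that $\widetilde g(U(M))=\widetilde f(M)$ for all $M\in M_n(\mathbb{F})$. The maps $f$ and $g$ are PH-equivalent if there are a matrix $A=(a_{i,j})$ with entries in $\mathbb{F}^*$ and permutations $\tau,\tau'\in\mathfrak{S}_n$ such that $$g(\sigma)=f(\tau\sigma\tau'^{-1})\prod_{k=1}^n a_{(\tau\sigma\tau'^{-1})(k),\,k}\quad\text{for all }\sigma\in\mathfrak{S}_n$$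 (this is an equivalence relation). Two indices $i,j\in\{1,\dots,n\}$ are column-$f$-equivalent (respectively, row-$f$-equivalent) if $i=j$, or if $i\neq j$ and there is a vector $z\in(\mathbb{F}^*)^n$ such that $\widetilde f(M)=0$ for every $M\in M_n(\mathbb{F})$ with $m_{k,j}=z_k m_{k,i}$ for all $k$ (respectively, $m_{j,k}=z_k m_{i,k}$ for all $k$). These are equivalence relations on $\{1,\dots,n\}$; $c(f)$ (respectively, $r(f)$) denotes the list of the cardinalities of the column-$f$-equivalence classes (respectively, of the row-$f$-equivalence classes), in non-increasing order. Theorem. Let $f,g:\mathfrak{S}_n\to\mathbb{F}^*$. (A) Assume that $n\ge 2$, and let $U$ be a linear endomorphism of $M_n(\mathbb{F})$ such that, for all $M\in M_n(\mathbb{F})$, $\widetilde g(U(M))=0$ if and only if $\widetilde f(M)=0$. Then: (i) $U$ is bijective; (ii) $g$ is PH-equivalent to $f$ or to $f^T$; (iii) $(r(g),c(g))=(r(f),c(f))$ or $(r(g),c(g))=(c(f),r(f))$; (iv) there exists $\alpha\in\mathbb{F}^*$ such that $U$ is an $(\alpha f,g)$-transformation. (B) An $(f,g)$-transformation exists if and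 only if $g$ is PH-equivalent to $f$ or to $f^T$. -/

import Mathlib

noncomputable section

namespace SchurFunctional

variable {F : Type*} [Field F] {n : ℕ}

/-- The Schur functional `M ↦ ∑ σ, f σ * ∏ j, m_{σ(j), j}` attached to a nowhere-vanishing map
`f` from the symmetric group to the field `F` (nowhere-vanishing: values in `Fˣ`). -/
def schur (f : Equiv.Perm (Fin n) → Fˣ) (M : Matrix (Fin n) (Fin n) F) : F :=
  ∑ σ : Equiv.Perm (Fin n), (f σ : F) * ∏ j : Fin n, M (σ j) j

/-- A linear endomorphism `U` of the space of `n` by `n` matrices is an `(f, g)`-transformation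
when the Schur functional of `g` at `U M` equals that of `f` at `M`, for every `M`. -/
def IsTransformation (f g : Equiv.Perm (Fin n) → Fˣ)
    (U : Matrix (Fin n) (Fin n) F →ₗ[F] Matrix (Fin n) (Fin n) F) : Prop :=
  ∀ M : Matrix (Fin n) (Fin n) F, schur g (U M) = schur f M

/-- The transpose `σ ↦ f (σ⁻¹)` of `f`. -/
def transpose (f : Equiv.Perm (Fin n) → Fˣ) : Equiv.Perm (Fin n) → Fˣ :=
  fun σ => f σ⁻¹

/-- The right action of a triple `(A, τ, τ')`, where `A` has entries in `Fˣ` and `τ, τ'` are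
permutations, on maps `f`:
`f.(A, τ, τ') : σ ↦ f (τ σ τ'⁻¹) * ∏ k, a_{(τ σ τ'⁻¹)(k), k}`. -/
def phAct (f : Equiv.Perm (Fin n) → Fˣ) (A : Matrix (Fin n) (Fin n) Fˣ)
    (τ τ' : Equiv.Perm (Fin n)) : Equiv.Perm (Fin n) → Fˣ :=
  fun σ => f (τ * σ * τ'⁻¹) * ∏ k : Fin n, A ((τ * σ * τ'⁻¹) k) k

/-- PH-equivalence: `f` and `g` lie in the same orbit of the action `phAct`. -/
def PHEquiv (f g : Equiv.Perm (Fin n) → Fˣ) : Prop :=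
  ∃ (A : Matrix (Fin n) (Fin n) Fˣ) (τ τ' : Equiv.Perm (Fin n)), phAct f A τ τ' = g

/-- Column-`f`-equivalence of two indices: they are equal, or there is a vector `Z` with nonzero
entries such that the Schur functional of `f` vanishes at every matrix whose `j`-th column is the
entrywise product of `Z` with its `i`-th column. -/
def ColEquiv (f : Equiv.Perm (Fin n) → Fˣ) (i j : Fin n) : Prop :=
  i = j ∨ (i ≠ j ∧ ∃ Z : Fin n → Fˣ, ∀ M : Matrix (Fin n) (Fin n) F,
    (∀ k : Fin n, M k j = (Z k : F) * M k i) → schur f M = 0)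

/-- Row-`f`-equivalence of two indices: they are equal, or there is a vector `Z` with nonzero
entries such that the Schur functional of `f` vanishes at every matrix whose `j`-th row is the
entrywise product of `Z` with its `i`-th row. -/
def RowEquiv (f : Equiv.Perm (Fin n) → Fˣ) (i j : Fin n) : Prop :=
  i = j ∨ (i ≠ j ∧ ∃ Z : Fin n → Fˣ, ∀ M : Matrix (Fin n) (Fin n) F,
    (∀ k : Fin n, M j k = (Z k : F) * M i k) → schur f M = 0)

open Classical in
/-- The class `{j | r i j}` of the index `i` for a relation `r`. -/
def relClass (r : Fin n → Fin n → Prop) (i : Fin n) : Finset (Fin n) :=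
  Finset.univ.filter fun j => r i j

/-- The cardinality list of an equivalence relation on the indices: the cardinalities of its
classes (each class counted once), in non-increasing order. -/
def cardList (r : Fin n → Fin n → Prop) : List ℕ :=
  ((Finset.univ.image (relClass r)).val.map Finset.card).sort (· ≥ ·)

/-- The column list `c(f)`: cardinality list of the set of column-`f`-equivalence classes. -/
def colList (f : Equiv.Perm (Fin n) → Fˣ) : List ℕ :=
  cardList (ColEquiv f)

/-- The row list `r(f)`: cardinality list of the set of row-`f`-equivalence classes. -/
def rowList (f : Equiv.Perm (Fin n) → Fˣ) : List ℕ :=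
  cardList (RowEquiv f)

end SchurFunctional

end

noncomputable section

namespace SchurFunctional

open Finset Module

variable {F : Type*} [Field F] {n : ℕ}

/-! This is a Dieudonné-type argument: the zero set of a Schur functional is studied through the
linear subspaces it contains. Such a subspace has codimension at least `n`
(`Vanishes.finrank_add_le`). When the codimension is exactly `n` and `n ≥ 2`, the subspace or its
transpose is cut out by one linear relation between the columns, with row-dependent coefficients
(`Vanishes.isColType_or`).

A map `U` preserving zeros in both directions is injective, so it sends the matrices with zero
`j`-th column to such an extremal subspace. After a transposition if necessary, the image is of
column type for one `j`. A row-dependent column operation which leaves the target functional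
unchanged (`schur_colOp`) then turns this image into a space of matrices with a zero column. Doing
this for every column, then for every row, makes the map permute the zero-column spaces and the
zero-row spaces. The two types cannot mix, since otherwise some entry would vanish on the whole
image, or on the whole source.

Such a map permutes the entries and rescales them, so it turns the functional of `g` into that of a
PH-equivalent map with the same zeros as `f`. Two Schur functionals with the same zeros are
proportional (`exists_proportional`), and a scalar can be absorbed into one column. Part (B) follows
since an `(f, g)`-transformation preserves zeros; sizes `n ≤ 1` are immediate. -/

/-! ### Schur functionals as functions of one column -/

theorem schur_updateCol (f : Equiv.Perm (Fin n) → Fˣ) (M : Matrix (Fin n) (Fin n) F) (j : Fin n)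
    (x : Fin n → F) :
    schur f (M.updateCol j x) =
      ∑ σ : Equiv.Perm (Fin n), (f σ : F) * (x (σ j) * ∏ l ∈ univ.erase j, M (σ l) l) := by
  unfold schur
  refine sum_congr rfl fun σ _ => ?_
  rw [← mul_prod_erase univ _ (mem_univ j)]
  congr 2
  · simp
  · refine prod_congr rfl fun l hl => ?_
    rw [Matrix.updateCol_ne (ne_of_mem_erase hl)]

/-- The Schur functional as a linear form in its `j`-th column. -/
def schurCol (f : Equiv.Perm (Fin n) → Fˣ) (M : Matrix (Fin n) (Fin n) F) (j : Fin n) :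
    (Fin n → F) →ₗ[F] F where
  toFun x := schur f (M.updateCol j x)
  map_add' x y := by
    simp only [schur_updateCol, ← sum_add_distrib]
    exact sum_congr rfl fun σ _ => by simp only [Pi.add_apply]; ring
  map_smul' c x := by
    simp only [schur_updateCol, smul_eq_mul, mul_sum, RingHom.id_apply]
    exact sum_congr rfl fun σ _ => by simp only [Pi.smul_apply, smul_eq_mul]; ring

theorem schurCol_apply (f : Equiv.Perm (Fin n) → Fˣ) (M : Matrix (Fin n) (Fin n) F) (j : Fin n)
    (x : Fin n → F) : schurCol f M j x = schur f (M.updateCol j x) := rfl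

theorem schurCol_self (f : Equiv.Perm (Fin n) → Fˣ) (M : Matrix (Fin n) (Fin n) F) (j : Fin n) :
    schurCol f M j (fun i => M i j) = schur f M := by
  rw [schurCol_apply]
  congr 1
  ext a b
  by_cases h : b = j
  · subst h; simp
  · simp [Matrix.updateCol_ne h]

theorem schurCol_congr (f : Equiv.Perm (Fin n) → Fˣ) {M N : Matrix (Fin n) (Fin n) F} {j : Fin n}
    (h : ∀ i, ∀ l ≠ j, M i l = N i l) : schurCol f M j = schurCol f N j := by
  refine LinearMap.ext fun x => ?_
  simp only [schurCol_apply]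
  congr 1
  ext a b
  by_cases hb : b = j
  · subst hb; simp
  · simp [Matrix.updateCol_ne hb, h a b hb]

theorem schur_eq_zero_of_col (f : Equiv.Perm (Fin n) → Fˣ) {M : Matrix (Fin n) (Fin n) F}
    {j : Fin n} (h : ∀ i, M i j = 0) : schur f M = 0 := by
  rw [← schurCol_self f M j, show (fun i => M i j) = 0 from funext h, map_zero]

/-- A permutation is determined by its values off one index. -/
theorem perm_eq_of_forall_ne {σ τ : Equiv.Perm (Fin n)} {j : Fin n} (h : ∀ l ≠ j, τ l = σ l) :
    τ = σ := by
  have key : ∀ l ≠ j, (σ⁻¹ * τ) l = l := fun l hl => by simp [h l hl]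
  have hj : (σ⁻¹ * τ) j = j := by
    by_contra hne
    exact hne ((σ⁻¹ * τ).injective (key _ hne))
  ext1 l
  by_cases hl : l = j
  · subst hl
    rw [Equiv.Perm.mul_apply, Equiv.Perm.inv_eq_iff_eq] at hj
    exact hj
  · exact h l hl

theorem schur_of_forall_ne (f : Equiv.Perm (Fin n) → Fˣ) {M : Matrix (Fin n) (Fin n) F}
    {j : Fin n} {σ : Equiv.Perm (Fin n)} (h : ∀ i, ∀ l ≠ j, M i l = if i = σ l then 1 else 0) :
    schur f M = f σ * M (σ j) j := by
  unfold schur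
  rw [sum_eq_single σ]
  · rw [← mul_prod_erase univ _ (mem_univ j), prod_eq_one, mul_one]
    intro l hl
    simp [h (σ l) l (ne_of_mem_erase hl)]
  · intro τ _ hτ
    obtain ⟨l, hl, hne⟩ : ∃ l ≠ j, τ l ≠ σ l := by
      by_contra! hc
      exact hτ (perm_eq_of_forall_ne hc)
    rw [prod_eq_zero (mem_univ l), mul_zero]
    simp [h _ l hl, hne]
  · simp

theorem schur_eq_zero_of_two (f : Equiv.Perm (Fin n) → Fˣ) {M : Matrix (Fin n) (Fin n) F}
    {l l' a : Fin n} (hll : l ≠ l') (h : ∀ i ≠ a, M i l = 0) (h' : ∀ i ≠ a, M i l' = 0) :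
    schur f M = 0 := by
  refine sum_eq_zero fun σ _ => ?_
  by_cases h1 : σ l = a
  · rw [prod_eq_zero (mem_univ l'), mul_zero]
    exact h' _ fun h2 => hll (σ.injective (h1.trans h2.symm))
  · rw [prod_eq_zero (mem_univ l), mul_zero]
    exact h _ h1

theorem schur_transpose (f : Equiv.Perm (Fin n) → Fˣ) (M : Matrix (Fin n) (Fin n) F) :
    schur (transpose f) M.transpose = schur f M := by
  unfold schur transpose
  refine Fintype.sum_equiv (Equiv.inv _) _ _ fun σ => ?_
  simp only [Equiv.inv_apply, Matrix.transpose_apply]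
  congr 1
  exact Fintype.prod_equiv σ _ _ fun j => by simp

theorem transpose_transpose (f : Equiv.Perm (Fin n) → Fˣ) : transpose (transpose f) = f := by
  funext σ; simp [transpose]

theorem schur_transpose' (f : Equiv.Perm (Fin n) → Fˣ) (M : Matrix (Fin n) (Fin n) F) :
    schur (transpose f) M = schur f M.transpose := by
  rw [← schur_transpose f, Matrix.transpose_transpose]

/-- The permutation matrix of `σ`, with entries `1` at the positions `(σ l, l)`. -/
def permMat (σ : Equiv.Perm (Fin n)) : Matrix (Fin n) (Fin n) F :=
  fun i l => if i = σ l then 1 else 0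

theorem schur_permMat (f : Equiv.Perm (Fin n) → Fˣ) (σ : Equiv.Perm (Fin n)) :
    schur f (permMat σ : Matrix (Fin n) (Fin n) F) = f σ := by
  unfold schur
  rw [sum_eq_single σ]
  · simp [permMat]
  · intro τ _ hτ
    obtain ⟨l, hne⟩ : ∃ l, τ l ≠ σ l := by
      by_contra! hc
      exact hτ (Equiv.ext hc)
    rw [prod_eq_zero (mem_univ l), mul_zero]
    simp [permMat, hne]
  · simp

theorem exists_perm_pair {j l k k' : Fin n} (hjl : j ≠ l) (hk : k ≠ k') :
    ∃ σ : Equiv.Perm (Fin n), σ j = k ∧ σ l = k' := by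
  refine ⟨Equiv.swap (Equiv.swap j k l) k' * Equiv.swap j k, ?_, ?_⟩
  · rw [Equiv.Perm.mul_apply, Equiv.swap_apply_left]
    refine Equiv.swap_apply_of_ne_of_ne (fun h => hjl ?_) hk
    apply (Equiv.swap j k).injective
    rw [← h, Equiv.swap_apply_left]
  · simp

/-! ### Cofactors -/

/-- Extension of a permutation by the value `i` at the inserted index `j`. -/
def extendPerm (i j : Fin (n + 1)) (σ : Equiv.Perm (Fin n)) : Equiv.Perm (Fin (n + 1)) :=
  ((finSuccEquiv' j).trans (Equiv.optionCongr σ)).trans (finSuccEquiv' i).symm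

theorem extendPerm_self (i j : Fin (n + 1)) (σ : Equiv.Perm (Fin n)) :
    extendPerm i j σ j = i := by simp [extendPerm]

theorem extendPerm_succAbove (i j : Fin (n + 1)) (σ : Equiv.Perm (Fin n)) (k : Fin n) :
    extendPerm i j σ (j.succAbove k) = i.succAbove (σ k) := by simp [extendPerm]

theorem extendPerm_injective (i j : Fin (n + 1)) :
    Function.Injective (extendPerm (n := n) i j) := by
  intro σ τ h
  ext1 k
  have := congrArg (fun ρ => ρ (j.succAbove k)) h
  simpa [extendPerm_succAbove] using this

theorem exists_extendPerm {i j : Fin (n + 1)} {τ : Equiv.Perm (Fin (n + 1))} (h : τ j = i) :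
    ∃ σ, extendPerm i j σ = τ := by
  have hs : ∀ k : Fin n, ∃ m, i.succAbove m = τ (j.succAbove k) := fun k =>
    Fin.exists_succAbove_eq fun hk => Fin.succAbove_ne j k (τ.injective (hk.trans h.symm))
  choose s hs using hs
  have hinj : Function.Injective s := by
    intro a b hab
    have := (hs a).symm.trans ((congrArg _ hab).trans (hs b))
    exact Fin.succAbove_right_injective (τ.injective this)
  refine ⟨Equiv.ofBijective s (Finite.injective_iff_bijective.mp hinj), ?_⟩
  refine perm_eq_of_forall_ne (j := j) fun l hl => ?_
  obtain ⟨k, rfl⟩ := Fin.exists_succAbove_eq hl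
  rw [extendPerm_succAbove, ← hs k]; rfl

/-- The map on permutations whose Schur functional is the `(i, j)` cofactor. -/
def minor (f : Equiv.Perm (Fin (n + 1)) → Fˣ) (i j : Fin (n + 1)) : Equiv.Perm (Fin n) → Fˣ :=
  fun σ => f (extendPerm i j σ)

theorem schur_of_row (f : Equiv.Perm (Fin (n + 1)) → Fˣ)
    {M : Matrix (Fin (n + 1)) (Fin (n + 1)) F} {i j : Fin (n + 1)} (h : ∀ l ≠ j, M i l = 0) :
    schur f M = M i j * schur (minor f i j) (M.submatrix i.succAbove j.succAbove) := by
  unfold schur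
  rw [mul_sum]
  symm
  refine sum_of_injOn (extendPerm i j) (extendPerm_injective i j).injOn (by simp) ?_ ?_
  · intro τ _ hτ
    have hne : τ⁻¹ i ≠ j := fun h' => hτ <| by
      obtain ⟨σ, hσ⟩ := exists_extendPerm (i := i) (j := j) (τ := τ)
        (by rw [← h']; simp)
      exact ⟨σ, by simp, hσ⟩
    rw [prod_eq_zero (mem_univ (τ⁻¹ i)), mul_zero]
    simpa using h _ hne
  · intro σ _
    rw [Fin.prod_univ_succAbove _ j, extendPerm_self]
    simp only [extendPerm_succAbove, minor, Matrix.submatrix_apply]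
    ring

/-! ### Codimension of subspaces of zeros -/

/-- The inclusion of column vectors as matrices supported in the `j`-th column. -/
def colLin (j : Fin n) : (Fin n → F) →ₗ[F] Matrix (Fin n) (Fin n) F where
  toFun x := Matrix.of fun i l => if l = j then x i else 0
  map_add' x y := by ext i l; by_cases h : l = j <;> simp [h]
  map_smul' c x := by ext i l; by_cases h : l = j <;> simp [h]

theorem colLin_apply (j : Fin n) (x : Fin n → F) (i l : Fin n) :
    colLin j x i l = if l = j then x i else 0 := rfl

theorem colLin_injective (j : Fin n) : Function.Injective (colLin (F := F) j) := by
  intro x y h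
  ext i
  simpa [colLin_apply] using congrFun (congrFun h i) j

/-- The column vectors which, placed in the `j`-th column, give an element of `V`. -/
def colPart (V : Submodule F (Matrix (Fin n) (Fin n) F)) (j : Fin n) : Submodule F (Fin n → F) :=
  V.comap (colLin j)

theorem mem_colPart {V : Submodule F (Matrix (Fin n) (Fin n) F)} {j : Fin n} {x : Fin n → F} :
    x ∈ colPart V j ↔ colLin j x ∈ V := Iff.rfl

/-- A linear subspace on which the Schur functional of `f` vanishes. -/
def Vanishes (f : Equiv.Perm (Fin n) → Fˣ) (V : Submodule F (Matrix (Fin n) (Fin n) F)) : Prop :=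
  ∀ M ∈ V, schur f M = 0

theorem schur_add_colLin (f : Equiv.Perm (Fin n) → Fˣ) (M : Matrix (Fin n) (Fin n) F) (j : Fin n)
    (x : Fin n → F) : schur f (M + colLin j x) = schur f M + schurCol f M j x := by
  rw [← schurCol_self f M j, ← map_add, ← schurCol_self f (M + colLin j x) j,
    schurCol_congr f (M := M + colLin j x) (N := M) (fun i l hl => by simp [colLin_apply, hl])]
  congr 1
  ext i
  simp [colLin_apply]

theorem Vanishes.schurCol_eq_zero {f : Equiv.Perm (Fin n) → Fˣ}
    {V : Submodule F (Matrix (Fin n) (Fin n) F)} (hV : Vanishes f V)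
    {M : Matrix (Fin n) (Fin n) F} (hM : M ∈ V) {j : Fin n} {x : Fin n → F}
    (hx : x ∈ colPart V j) : schurCol f M j x = 0 := by
  have h := schur_add_colLin f M j x
  rwa [hV _ (V.add_mem hM hx), hV _ hM, zero_add, eq_comm] at h

theorem finrank_le_map_add_inf_ker {E E' : Type*} [AddCommGroup E] [Module F E]
    [FiniteDimensional F E] [AddCommGroup E'] [Module F E'] (V : Submodule F E) (θ : E →ₗ[F] E') :
    finrank F V ≤ finrank F (V.map θ) + finrank F (V ⊓ LinearMap.ker θ : Submodule F E) := by
  have h := LinearMap.finrank_range_add_finrank_ker (θ.domRestrict V)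
  rw [LinearMap.range_domRestrict, LinearMap.ker_domRestrict] at h
  have h2 := Submodule.finrank_map_subtype_eq V (Submodule.comap V.subtype (LinearMap.ker θ))
  rw [Submodule.map_comap_subtype] at h2
  omega

/-- Choose `x` in the column part with `x i ≠ 0`. Killing row `i` off column `j` costs at most `n`
dimensions. On what remains, column `j` may be replaced by `x`, so the complementary blocks are
zeros of a cofactor and contribute at most `n * n - n` by `ih`. The matrices left over are supported
in column `j`. -/
theorem finrank_le_of_colPart_ne_bot
    (ih : ∀ (f : Equiv.Perm (Fin n) → Fˣ) (W : Submodule F (Matrix (Fin n) (Fin n) F)),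
      Vanishes f W → finrank F W + n ≤ n * n)
    {f : Equiv.Perm (Fin (n + 1)) → Fˣ}
    {V : Submodule F (Matrix (Fin (n + 1)) (Fin (n + 1)) F)} (hV : Vanishes f V)
    {j : Fin (n + 1)} (hj : colPart V j ≠ ⊥) :
    finrank F V ≤ n * n + finrank F (colPart V j) := by
  obtain ⟨x, hx, hx0⟩ := Submodule.exists_mem_ne_zero_of_ne_bot hj
  obtain ⟨i, hi⟩ := Function.ne_iff.mp hx0
  let ρ : Matrix (Fin (n + 1)) (Fin (n + 1)) F →ₗ[F] (Fin n → F) :=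
    { toFun := fun M l => M i (j.succAbove l)
      map_add' := fun _ _ => rfl
      map_smul' := fun _ _ => rfl }
  let κ : Matrix (Fin (n + 1)) (Fin (n + 1)) F →ₗ[F] Matrix (Fin n) (Fin n) F :=
    { toFun := fun M => M.submatrix i.succAbove j.succAbove
      map_add' := fun _ _ => rfl
      map_smul' := fun _ _ => rfl }
  have hrow : ∀ M ∈ LinearMap.ker ρ, ∀ l ≠ j, M i l = 0 := by
    intro M hM l hl
    obtain ⟨k, rfl⟩ := Fin.exists_succAbove_eq hl
    exact congrFun (LinearMap.mem_ker.mp hM) k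
  have h1 := finrank_le_map_add_inf_ker V ρ
  have h2 := finrank_le_map_add_inf_ker (V ⊓ LinearMap.ker ρ) κ
  have h3 : finrank F (V.map ρ) ≤ n := by
    simpa using (V.map ρ).finrank_le
  have h4 := ih (minor f i j) ((V ⊓ LinearMap.ker ρ).map κ) (by
    rintro _ ⟨M, ⟨hMV, hMρ⟩, rfl⟩
    have h := hV.schurCol_eq_zero hMV hx
    rw [schurCol_apply, schur_of_row f (i := i) (j := j)
      (fun l hl => by rw [Matrix.updateCol_ne hl, hrow M hMρ l hl])] at h
    rw [Matrix.updateCol_self] at h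
    have h' := (mul_eq_zero.mp h).resolve_left hi
    rw [← h']
    congr 1
    ext a b
    simp only [Matrix.submatrix_apply, Matrix.updateCol_ne (Fin.succAbove_ne j b)]
    rfl)
  have h5 : finrank F (V ⊓ LinearMap.ker ρ ⊓ LinearMap.ker κ : Submodule F _) ≤
      finrank F (colPart V j) := by
    have hle : V ⊓ LinearMap.ker ρ ⊓ LinearMap.ker κ ≤ (colPart V j).map (colLin j) := by
      rintro M ⟨⟨hMV, hMρ⟩, hMκ⟩
      have hsub : M.submatrix i.succAbove j.succAbove = 0 := LinearMap.mem_ker.mp hMκ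
      have hM : colLin j (fun a => M a j) = M := by
        ext a b
        rw [colLin_apply]
        split_ifs with h
        · rw [h]
        · by_cases ha : a = i
          · rw [ha, hrow M hMρ b h]
          · obtain ⟨b', rfl⟩ := Fin.exists_succAbove_eq h
            obtain ⟨a', rfl⟩ := Fin.exists_succAbove_eq ha
            exact (congrFun (congrFun hsub a') b').symm
      exact ⟨_, by rw [SetLike.mem_coe, mem_colPart, hM]; exact hMV, hM⟩
    exact (Submodule.finrank_mono hle).trans (Submodule.finrank_map_le _ _)
  omega

theorem finrank_matrix_fin : finrank F (Matrix (Fin n) (Fin n) F) = n * n := by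
  simp [Module.finrank_matrix]

theorem finrank_range_colLin (j : Fin n) : finrank F (LinearMap.range (colLin (F := F) j)) = n := by
  rw [LinearMap.finrank_range_of_inj (colLin_injective j)]; simp

theorem disjoint_of_colPart_eq_bot {V : Submodule F (Matrix (Fin n) (Fin n) F)} {j : Fin n}
    (h : colPart V j = ⊥) : Disjoint V (LinearMap.range (colLin j)) := by
  rw [Submodule.disjoint_def]
  rintro _ hM ⟨x, rfl⟩
  have : x ∈ colPart V j := hM
  rw [h, Submodule.mem_bot] at this
  rw [this, map_zero]

theorem sum_colLin (M : Matrix (Fin n) (Fin n) F) : M = ∑ j, colLin j (fun i => M i j) := by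
  ext i l
  simp [Matrix.sum_apply, colLin_apply]

theorem Vanishes.finrank_add_le (f : Equiv.Perm (Fin n) → Fˣ)
    (V : Submodule F (Matrix (Fin n) (Fin n) F)) (hV : Vanishes f V) :
    finrank F V + n ≤ n * n := by
  induction n with
  | zero =>
    have := V.finrank_le
    rw [finrank_matrix_fin] at this
    omega
  | succ n ih =>
    by_contra! hlt
    -- A subspace of codimension below `n + 1` meets every column space nontrivially, and the
    -- previous bound then makes each column part full. Hence the subspace contains the identity
    -- matrix, where the functional is nonzero.
    have hj : ∀ j, colPart V j = ⊤ := by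
      intro j
      have hne : colPart V j ≠ ⊥ := by
        intro h0
        have := Submodule.finrank_add_finrank_le_of_disjoint (disjoint_of_colPart_eq_bot h0)
        rw [finrank_range_colLin, finrank_matrix_fin] at this
        omega
      have := finrank_le_of_colPart_ne_bot ih hV hne
      apply Submodule.eq_top_of_finrank_eq
      refine le_antisymm (Submodule.finrank_le _) ?_
      rw [Module.finrank_fin_fun]
      nlinarith
    have h1 : (permMat 1 : Matrix (Fin (n + 1)) (Fin (n + 1)) F) ∈ V := by
      rw [sum_colLin (permMat 1)]
      refine V.sum_mem fun j _ => ?_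
      rw [← mem_colPart, hj]
      trivial
    have h2 := hV _ h1
    rw [schur_permMat] at h2
    exact (f 1).ne_zero h2

/-! ### Subspaces of zeros of minimal codimension -/

/-- A subspace defined, row by row, by one linear relation between the columns, in which the
coefficients of a given column either all vanish or are all nonzero. -/
def IsColType (V : Submodule F (Matrix (Fin n) (Fin n) F)) : Prop :=
  ∃ D : Matrix (Fin n) (Fin n) F, (∀ l, (∀ k, D k l = 0) ∨ ∀ k, D k l ≠ 0) ∧
    (∃ l, ∀ k, D k l ≠ 0) ∧ ∀ M, M ∈ V ↔ ∀ k, ∑ l, D k l * M k l = 0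

theorem schurCol_permMat (f : Equiv.Perm (Fin n) → Fˣ) (σ : Equiv.Perm (Fin n)) (j : Fin n)
    {M : Matrix (Fin n) (Fin n) F} (h : ∀ i, ∀ l ≠ j, M i l = permMat σ i l) (y : Fin n → F) :
    schurCol f M j y = f σ * y (σ j) := by
  rw [schurCol_apply, schur_of_forall_ne f (j := j) (σ := σ), Matrix.updateCol_self]
  intro i l hl
  rw [Matrix.updateCol_ne hl, h i l hl, permMat]

theorem updateCol_zero_add_colLin (M : Matrix (Fin n) (Fin n) F) {j l : Fin n} (hl : l ≠ j)
    (x y : Fin n → F) :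
    (M.updateCol j 0 + colLin l x).updateCol j y = M.updateCol j y + colLin l x := by
  ext a b
  by_cases hb : b = j
  · subst hb; simp [colLin_apply, hl.symm]
  · simp [Matrix.updateCol_ne hb]

theorem schurCol_permMat_add (f : Equiv.Perm (Fin n) → Fˣ) (σ : Equiv.Perm (Fin n)) {j l : Fin n}
    (hl : l ≠ j) (x y : Fin n → F) :
    schurCol f ((permMat σ).updateCol j 0 + colLin l x) j y =
      f σ * y (σ j) + schur f (((permMat σ).updateCol j y).updateCol l x) := by
  rw [schurCol_apply, updateCol_zero_add_colLin _ hl, schur_add_colLin, schurCol_apply,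
    ← schurCol_apply f _ j, schurCol_permMat f σ j fun _ _ _ => rfl]

theorem schur_permMat_swap (f : Equiv.Perm (Fin n) → Fˣ) (σ : Equiv.Perm (Fin n)) {j l : Fin n}
    (hl : l ≠ j) (y : Fin n → F) :
    schur f (((permMat σ).updateCol j y).updateCol l (Pi.single (σ j) 1)) =
      f (σ * Equiv.swap j l) * y (σ l) := by
  rw [schur_of_forall_ne f (j := j) (σ := σ * Equiv.swap j l), Matrix.updateCol_ne hl.symm,
    Matrix.updateCol_self, Equiv.Perm.mul_apply, Equiv.swap_apply_left]
  intro i b hb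
  by_cases hbl : b = l
  · subst hbl
    simp [Pi.single_apply]
  · rw [Matrix.updateCol_ne hbl, Matrix.updateCol_ne hb, permMat, Equiv.Perm.mul_apply,
      Equiv.swap_apply_of_ne_of_ne hb hbl]

theorem permMat_updateCol_zero (σ : Equiv.Perm (Fin n)) (j : Fin n) :
    (permMat σ : Matrix (Fin n) (Fin n) F).updateCol j 0 =
      ∑ l ∈ univ.erase j, colLin l (Pi.single (σ l) 1) := by
  ext a b
  by_cases hb : b = j
  · subst hb
    simp [Matrix.sum_apply, colLin_apply]
  · simp [Matrix.sum_apply, colLin_apply, permMat, hb, Pi.single_apply]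

section Graph

variable {f : Equiv.Perm (Fin n) → Fˣ} {j : Fin n}
  {ψ : Matrix (Fin n) (Fin n) F →ₗ[F] (Fin n → F)}

/-- In this section `ψ` stands for the projection onto column `j` along an extremal subspace
complementary to that column. Testing the identity `hψ` on permutation matrices with column `j`
erased, and on perturbations of one further column, shows that `ψ` acts row by row. -/
theorem graph_permMat (hψ : ∀ M, schur f M = schurCol f M j (ψ M)) (σ : Equiv.Perm (Fin n)) :
    ψ ((permMat σ).updateCol j 0) (σ j) = 0 := by
  have h := hψ ((permMat σ).updateCol j 0)
  rw [schur_eq_zero_of_col f (j := j) (by simp), schurCol_permMat f σ j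
    (fun i l hl => by rw [Matrix.updateCol_ne hl])] at h
  exact (mul_eq_zero.mp h.symm).resolve_left (f σ).ne_zero

theorem graph_permMat_add (hψ : ∀ M, schur f M = schurCol f M j (ψ M)) (σ : Equiv.Perm (Fin n))
    {l : Fin n} (hl : l ≠ j) (x : Fin n → F) :
    f σ * ψ (colLin l x) (σ j) + schur f (((permMat σ).updateCol j
      (ψ ((permMat σ).updateCol j 0) + ψ (colLin l x))).updateCol l x) = 0 := by
  have h := hψ ((permMat σ).updateCol j 0 + colLin l x)
  rw [schur_eq_zero_of_col f (j := j) (by simp [colLin_apply, hl.symm]),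
    schurCol_permMat_add f σ hl, map_add, Pi.add_apply, graph_permMat hψ, zero_add] at h
  exact h.symm

theorem graph_offDiag (hψ : ∀ M, schur f M = schurCol f M j (ψ M)) {l a k : Fin n} (hl : l ≠ j)
    (hak : a ≠ k) : ψ (colLin l (Pi.single a 1)) k = 0 := by
  by_cases hex : ∃ l', l' ≠ j ∧ l' ≠ l
  · obtain ⟨l', hj, hl'⟩ := hex
    obtain ⟨σ, rfl, rfl⟩ := exists_perm_pair hj.symm hak.symm
    -- Columns `l` and `l'` are now both supported in row `σ l'`, so the second term vanishes.
    have h := graph_permMat_add hψ σ hl (Pi.single (σ l') 1)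
    rw [schur_eq_zero_of_two f hl'.symm (a := σ l'), add_zero] at h
    · exact (mul_eq_zero.mp h).resolve_left (f σ).ne_zero
    · intro i hi
      simp [hi]
    · intro i hi
      simp [Matrix.updateCol_ne hl', Matrix.updateCol_ne hj, permMat, hi]
  -- Here `n = 2`: erasing column `j` leaves only column `l`.
  · push Not at hex
    obtain ⟨σ, rfl, rfl⟩ := exists_perm_pair hl.symm hak.symm
    have h := graph_permMat hψ σ
    have he : univ.erase j = {l} := by
      ext l'
      simp only [mem_erase, mem_univ, and_true, mem_singleton]
      exact ⟨hex l', fun h => h ▸ hl⟩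
    rwa [permMat_updateCol_zero, he, sum_singleton] at h

/-- Exchanging the values at `j` and `l` of a permutation relates the coefficient at row `k` to the
one at row `k'`. This yields the all-or-nothing condition in `IsColType`. -/
theorem graph_diag (hψ : ∀ M, schur f M = schurCol f M j (ψ M)) {l k k' : Fin n} (hl : l ≠ j)
    (h0 : ψ (colLin l (Pi.single k' 1)) k' = 0) : ψ (colLin l (Pi.single k 1)) k = 0 := by
  by_cases hk : k = k'
  · rwa [hk]
  obtain ⟨σ, rfl, rfl⟩ := exists_perm_pair hl.symm hk
  have h := graph_permMat_add hψ σ hl (Pi.single (σ j) 1)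
  have h1 : ψ ((permMat σ).updateCol j 0) (σ l) = 0 := by
    rw [permMat_updateCol_zero, map_sum, Finset.sum_apply]
    refine sum_eq_zero fun l' hl' => ?_
    by_cases hll : l' = l
    · rw [hll, h0]
    · exact graph_offDiag hψ (ne_of_mem_erase hl') fun h => hll (σ.injective h)
  rw [schur_permMat_swap f σ hl, Pi.add_apply, h1, graph_offDiag hψ hl hk, add_zero, mul_zero,
    add_zero] at h
  exact (mul_eq_zero.mp h).resolve_left (f σ).ne_zero

end Graph

theorem matrix_eq_sum_colLin (M : Matrix (Fin n) (Fin n) F) :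
    M = ∑ l, ∑ i, M i l • colLin l (Pi.single i 1) := by
  ext a b
  simp [Matrix.sum_apply, colLin_apply, Pi.single_apply]

/-- By dimension, `V` is a complement of the `j`-th column space, hence the kernel of a projection
`ψ` onto that column. Linearity in column `j` gives the identity studied above, and the diagonal
coefficients of `ψ` form `D`. -/
theorem Vanishes.isColType {f : Equiv.Perm (Fin n) → Fˣ}
    {V : Submodule F (Matrix (Fin n) (Fin n) F)} (hV : Vanishes f V)
    (hdim : finrank F V + n = n * n) {j : Fin n} (hj : colPart V j = ⊥) : IsColType V := by
  have hinj : Function.Injective (V.mkQ ∘ₗ colLin j) := by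
    rw [injective_iff_map_eq_zero]
    intro x hx
    rw [LinearMap.comp_apply, Submodule.mkQ_apply, Submodule.Quotient.mk_eq_zero,
      ← mem_colPart, hj] at hx
    exact hx
  have hq := V.finrank_quotient_add_finrank
  rw [finrank_matrix_fin] at hq
  have hsurj := (LinearMap.injective_iff_surjective_of_finrank_eq_finrank (by
    rw [Module.finrank_fin_fun]; omega)).mp hinj
  let e := LinearEquiv.ofBijective _ ⟨hinj, hsurj⟩
  let ψ : Matrix (Fin n) (Fin n) F →ₗ[F] (Fin n → F) := e.symm.toLinearMap ∘ₗ V.mkQ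
  have he : ∀ x, e x = V.mkQ (colLin j x) := fun _ => rfl
  have hψV : ∀ M, M ∈ V ↔ ψ M = 0 := by
    intro M
    simp [ψ]
  have hψj : ∀ x, ψ (colLin j x) = x := by
    intro x
    change e.symm (V.mkQ (colLin j x)) = x
    rw [← he, e.symm_apply_apply]
  have hψ : ∀ M, schur f M = schurCol f M j (ψ M) := by
    intro M
    have h := hV (M + colLin j (-ψ M)) (by
      rw [hψV, map_add, hψj, add_neg_cancel])
    rw [schur_add_colLin, map_neg] at h
    linear_combination h
  have hc : ∀ l a k, a ≠ k → ψ (colLin l (Pi.single a 1)) k = 0 := by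
    intro l a k hak
    by_cases hl : l = j
    · rw [hl, hψj, Pi.single_eq_of_ne hak.symm]
    · exact graph_offDiag hψ hl hak
  refine ⟨fun k l => ψ (colLin l (Pi.single k 1)) k, fun l => ?_, ⟨j, fun k => ?_⟩, fun M => ?_⟩
  · by_cases hl : l = j
    · right
      intro k
      beta_reduce
      rw [hl, hψj]
      simp
    · by_cases h0 : ∃ k, ψ (colLin l (Pi.single k 1)) k = 0
      · obtain ⟨k, hk⟩ := h0
        exact Or.inl fun k' => graph_diag hψ hl hk
      · push Not at h0
        exact Or.inr h0
  · beta_reduce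
    rw [hψj]
    simp
  · rw [hψV, funext_iff]
    refine forall_congr' fun k => ?_
    conv_lhs => rw [matrix_eq_sum_colLin M]
    simp only [map_sum, map_smul, Finset.sum_apply, Pi.smul_apply, smul_eq_mul, Pi.zero_apply]
    rw [sum_congr rfl fun l _ => sum_eq_single k (fun a _ ha => by rw [hc l a k ha, mul_zero])
      (by simp)]
    simp only [mul_comm]

/-- The space of transposes of the elements of `V`. -/
def transposeSub (V : Submodule F (Matrix (Fin n) (Fin n) F)) :
    Submodule F (Matrix (Fin n) (Fin n) F) :=
  V.comap (Matrix.transposeLinearEquiv (Fin n) (Fin n) F F).toLinearMap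

theorem mem_transposeSub {V : Submodule F (Matrix (Fin n) (Fin n) F)}
    {M : Matrix (Fin n) (Fin n) F} : M ∈ transposeSub V ↔ M.transpose ∈ V := Iff.rfl

theorem finrank_transposeSub (V : Submodule F (Matrix (Fin n) (Fin n) F)) :
    finrank F (transposeSub V) = finrank F V := by
  rw [transposeSub, Submodule.comap_equiv_eq_map_symm]
  exact LinearEquiv.finrank_map_eq _ _

theorem Vanishes.transposeSub {f : Equiv.Perm (Fin n) → Fˣ}
    {V : Submodule F (Matrix (Fin n) (Fin n) F)} (hV : Vanishes f V) :
    Vanishes (transpose f) (transposeSub V) := by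
  intro M hM
  rw [schur_transpose']
  exact hV _ hM

/-- The column parts are independent, and their dimensions already add up to that of `V`, so `V` is
their direct sum. -/
theorem mem_of_finrank_colPart_le {V : Submodule F (Matrix (Fin (n + 1)) (Fin (n + 1)) F)}
    (hdim : finrank F V = n * (n + 1)) (h : ∀ j, n ≤ finrank F (colPart V j))
    {M : Matrix (Fin (n + 1)) (Fin (n + 1)) F} (hM : M ∈ V) (j : Fin (n + 1)) :
    colLin j (fun i => M i j) ∈ V := by
  let θ : ((j : Fin (n + 1)) → colPart V j) →ₗ[F] V :=
    { toFun := fun x => ⟨∑ j, colLin j (x j).1, V.sum_mem fun j _ => mem_colPart.mp (x j).2⟩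
      map_add' := fun x y => by ext1; simp [sum_add_distrib]
      map_smul' := fun c x => by ext1; simp [smul_sum] }
  have hθ : ∀ x j i, (θ x).1 i j = (x j).1 i := fun x j i => by
    simp [θ, Matrix.sum_apply, colLin_apply]
  have hinj : Function.Injective θ := by
    intro x y hxy
    funext j
    ext i
    rw [← hθ, ← hθ, hxy]
  have hle := LinearMap.finrank_le_finrank_of_injective hinj
  have hsum : n * (n + 1) ≤ finrank F ((j : Fin (n + 1)) → colPart V j) := by
    rw [Module.finrank_pi_fintype]
    calc n * (n + 1) = ∑ _j : Fin (n + 1), n := by simp [mul_comm]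
      _ ≤ _ := sum_le_sum fun j _ => h j
  have hsurj := (LinearMap.injective_iff_surjective_of_finrank_eq_finrank
    (le_antisymm hle (by rw [hdim]; exact hsum))).mp hinj
  obtain ⟨x, hx⟩ := hsurj ⟨M, hM⟩
  have hcol : (fun i => M i j) = (x j).1 := by
    funext i
    rw [← hθ, hx]
  rw [hcol, ← mem_colPart]
  exact (x j).2

theorem subsingleton_of_le_finrank {W : Submodule F (Fin (n + 1) → F)} (hW : n ≤ finrank F W)
    {k l : Fin (n + 1)} (hk : ∀ x ∈ W, x k = 0) (hl : ∀ x ∈ W, x l = 0) : k = l := by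
  by_contra hkl
  let θ : (Fin (n + 1) → F) →ₗ[F] F × F :=
    (LinearMap.proj k).prod (LinearMap.proj l)
  have hsurj : Function.Surjective θ := by
    rintro ⟨a, b⟩
    refine ⟨Pi.single k a + Pi.single l b, ?_⟩
    simp [θ, hkl, Ne.symm hkl]
  have h1 := LinearMap.finrank_range_add_finrank_ker θ
  rw [LinearMap.range_eq_top.mpr hsurj, finrank_top] at h1
  have h2 : W ≤ LinearMap.ker θ := fun x hx => by simp [θ, hk x hx, hl x hx]
  have h3 := Submodule.finrank_mono h2
  simp only [finrank_prod, finrank_self, Module.finrank_fin_fun] at h1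
  omega

/-- A set of positions with at most one element per row and per column is avoided by some
permutation. -/
theorem exists_perm_avoiding (hn : 2 ≤ n) {B : Fin n → Fin n → Prop}
    (hcol : ∀ j k l, B k j → B l j → k = l) (hrow : ∀ k j l, B k j → B k l → j = l) :
    ∃ σ : Equiv.Perm (Fin n), ∀ j, ¬ B (σ j) j := by
  classical
  obtain ⟨s, hs, hsB⟩ := (Finset.all_card_le_biUnion_card_iff_exists_injective
    (fun j : Fin n => univ.filter fun k => ¬ B k j)).mp (by
      intro s
      by_cases h1 : s.card ≤ 1
      · rcases s.eq_empty_or_nonempty with rfl | ⟨j, hj⟩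
        · simp
        · refine h1.trans (Finset.card_pos.mpr ?_)
          have h01 : (⟨0, by omega⟩ : Fin n) ≠ ⟨1, by omega⟩ := by simp
          by_cases h0 : B ⟨0, by omega⟩ j
          · refine ⟨⟨1, by omega⟩, mem_biUnion.mpr ⟨j, hj, mem_filter.mpr ⟨mem_univ _, ?_⟩⟩⟩
            exact fun h => h01 (hcol j _ _ h0 h)
          · exact ⟨⟨0, by omega⟩, mem_biUnion.mpr ⟨j, hj, by simpa using h0⟩⟩
      · obtain ⟨j, hj, l, hl, hjl⟩ := Finset.one_lt_card.mp (not_le.mp h1)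
        rw [show (s.biUnion fun j : Fin n => univ.filter fun k => ¬ B k j) = univ from ?_]
        · exact card_le_univ s
        · refine eq_univ_of_forall fun k => ?_
          by_cases hk : B k j
          · exact mem_biUnion.mpr ⟨l, hl, by simpa using fun h => hjl (hrow k _ _ hk h)⟩
          · exact mem_biUnion.mpr ⟨j, hj, by simpa using hk⟩)
  refine ⟨Equiv.ofBijective s (Finite.injective_iff_bijective.mp hs), fun j => ?_⟩
  simpa using hsB j

theorem Vanishes.le_finrank_colPart {f : Equiv.Perm (Fin (n + 1)) → Fˣ}
    {V : Submodule F (Matrix (Fin (n + 1)) (Fin (n + 1)) F)} (hV : Vanishes f V)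
    (hdim : finrank F V = n * (n + 1)) {j : Fin (n + 1)} (hj : colPart V j ≠ ⊥) :
    n ≤ finrank F (colPart V j) := by
  have := finrank_le_of_colPart_ne_bot (fun f W hW => Vanishes.finrank_add_le f W hW) hV hj
  rw [hdim, mul_add, mul_one] at this
  omega

/-- If no column or row part were zero, all would have codimension at most one and `V` would split
along both columns and rows, so it would be spanned by matrix units. At most one unit per row and
per column would be missing, so `V` would contain a permutation matrix, which is not a zero. -/
theorem Vanishes.exists_colPart_eq_bot (hn : 2 ≤ n) {f : Equiv.Perm (Fin n) → Fˣ}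
    {V : Submodule F (Matrix (Fin n) (Fin n) F)} (hV : Vanishes f V)
    (hdim : finrank F V + n = n * n) :
    (∃ j, colPart V j = ⊥) ∨ ∃ i, colPart (SchurFunctional.transposeSub V) i = ⊥ := by
  obtain ⟨n, rfl⟩ : ∃ m, n = m + 1 := ⟨n - 1, by omega⟩
  by_contra! hc
  obtain ⟨hC, hR⟩ := hc
  have hdim' : finrank F V = n * (n + 1) := by
    rw [show (n + 1) * (n + 1) = n * (n + 1) + (n + 1) by ring] at hdim
    omega
  have hdimT := (finrank_transposeSub V).trans hdim'
  have hC' := fun j => hV.le_finrank_colPart hdim' (hC j)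
  have hR' := fun i => hV.transposeSub.le_finrank_colPart hdimT (hR i)
  have hsingle : ∀ M ∈ V, ∀ i j, M i j ≠ 0 → colLin j (Pi.single i 1) ∈ V := by
    intro M hM i j hne
    have h1 := mem_of_finrank_colPart_le hdim' hC' hM j
    have h2 := mem_of_finrank_colPart_le hdimT hR' (M := (colLin j fun i => M i j).transpose)
      (mem_transposeSub.mpr (by rwa [Matrix.transpose_transpose])) i
    rw [mem_transposeSub] at h2
    have h3 := V.smul_mem (M i j)⁻¹ h2
    convert h3 using 1
    ext a b
    by_cases ha : a = i <;> by_cases hb : b = j <;>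
      simp [colLin_apply, ha, hb, hne]
  obtain ⟨σ, hσ⟩ := exists_perm_avoiding hn
    (B := fun i j => colLin j (Pi.single i 1) ∉ V)
    (fun j k l hk hl => subsingleton_of_le_finrank (hC' j)
      (fun x hx => by
        by_contra hne
        exact hk (hsingle _ hx k j (by simpa [colLin_apply] using hne)))
      (fun x hx => by
        by_contra hne
        exact hl (hsingle _ hx l j (by simpa [colLin_apply] using hne))))
    (fun k j l hj hl => subsingleton_of_le_finrank (hR' k)
      (fun x hx => by
        by_contra hne
        exact hj (hsingle _ hx k j (by simpa [colLin_apply] using hne)))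
      (fun x hx => by
        by_contra hne
        exact hl (hsingle _ hx k l (by simpa [colLin_apply] using hne))))
  have hmem : (permMat σ : Matrix (Fin (n + 1)) (Fin (n + 1)) F) ∈ V := by
    rw [sum_colLin (permMat σ)]
    refine V.sum_mem fun j _ => ?_
    convert not_not.mp (hσ j) using 2
    funext i
    simp [permMat, Pi.single_apply]
  have h := hV _ hmem
  rw [schur_permMat] at h
  exact (f σ).ne_zero h

/-- Subspaces of minimal codimension on which a Schur functional vanishes. -/
theorem Vanishes.isColType_or (hn : 2 ≤ n) {f : Equiv.Perm (Fin n) → Fˣ}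
    {V : Submodule F (Matrix (Fin n) (Fin n) F)} (hV : Vanishes f V)
    (hdim : finrank F V + n = n * n) :
    IsColType V ∨ IsColType (SchurFunctional.transposeSub V) := by
  rcases hV.exists_colPart_eq_bot hn hdim with ⟨j, hj⟩ | ⟨i, hi⟩
  · exact Or.inl (hV.isColType hdim hj)
  · exact Or.inr (hV.transposeSub.isColType (by rwa [finrank_transposeSub]) hi)

/-! ### Zero columns, zero rows and operations preserving the functional -/

/-- The space of matrices with zero `j`-th column. -/
def colZero (F : Type*) [Field F] (j : Fin n) : Submodule F (Matrix (Fin n) (Fin n) F) where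
  carrier := {M | ∀ i, M i j = 0}
  add_mem' {M N} hM hN i := by simp [hM i, hN i]
  zero_mem' _ := rfl
  smul_mem' c M hM i := by simp [hM i]

/-- The space of matrices with zero `i`-th row. -/
def rowZero (F : Type*) [Field F] (i : Fin n) : Submodule F (Matrix (Fin n) (Fin n) F) where
  carrier := {M | ∀ j, M i j = 0}
  add_mem' {M N} hM hN j := by simp [hM j, hN j]
  zero_mem' _ := rfl
  smul_mem' c M hM j := by simp [hM j]

theorem mem_colZero {j : Fin n} {M : Matrix (Fin n) (Fin n) F} :
    M ∈ colZero F j ↔ ∀ i, M i j = 0 := Iff.rfl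

theorem mem_rowZero {i : Fin n} {M : Matrix (Fin n) (Fin n) F} :
    M ∈ rowZero F i ↔ ∀ j, M i j = 0 := Iff.rfl

theorem transposeSub_colZero (j : Fin n) : transposeSub (colZero F j) = rowZero F j := rfl

theorem vanishes_colZero (f : Equiv.Perm (Fin n) → Fˣ) (j : Fin n) :
    Vanishes f (colZero F j) := fun _ hM => schur_eq_zero_of_col f hM

theorem vanishes_rowZero (f : Equiv.Perm (Fin n) → Fˣ) (i : Fin n) :
    Vanishes f (rowZero F i) := by
  have := (vanishes_colZero (transpose f) i).transposeSub
  rwa [transpose_transpose] at this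

theorem finrank_colZero (j : Fin n) : finrank F (colZero F j) + n = n * n := by
  have hle := Vanishes.finrank_add_le (fun _ => (1 : Fˣ)) _ (vanishes_colZero _ j)
  have h := finrank_le_map_add_inf_ker (⊤ : Submodule F (Matrix (Fin n) (Fin n) F))
    ({ toFun := fun M i => M i j
       map_add' := fun _ _ => rfl
       map_smul' := fun _ _ => rfl } : Matrix (Fin n) (Fin n) F →ₗ[F] (Fin n → F))
  rw [top_inf_eq, finrank_top, finrank_matrix_fin] at h
  refine le_antisymm hle (h.trans ?_)
  rw [add_comm]
  refine add_le_add (Submodule.finrank_mono fun M hM i => ?_) ?_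
  · exact congrFun (LinearMap.mem_ker.mp hM) i
  · exact (Submodule.finrank_le _).trans (by simp)

theorem finrank_rowZero (i : Fin n) : finrank F (rowZero F i) + n = n * n := by
  rw [← transposeSub_colZero, finrank_transposeSub, finrank_colZero]

theorem colZero_add_colZero {j l : Fin n} (h : j ≠ l) (M : Matrix (Fin n) (Fin n) F) :
    ∃ M₁ ∈ colZero F j, ∃ M₂ ∈ colZero F l, M = M₁ + M₂ := by
  refine ⟨M - colLin j (fun i => M i j), fun i => ?_, colLin j (fun i => M i j), fun i => ?_, ?_⟩
  · simp [colLin_apply]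
  · simp [colLin_apply, h.symm]
  · simp

theorem exists_single_add (i j : Fin n) (M : Matrix (Fin n) (Fin n) F) :
    ∃ M₁ ∈ rowZero F i, ∃ M₂ ∈ colZero F j, M = M i j • colLin j (Pi.single i 1) + M₁ + M₂ := by
  refine ⟨colLin j (fun a => if a = i then 0 else M a j), fun l => ?_,
    M - colLin j (fun a => M a j), fun a => ?_, ?_⟩
  · simp [colLin_apply]
  · simp [colLin_apply]
  · ext a b
    by_cases ha : a = i <;> by_cases hb : b = j <;> simp [colLin_apply, ha, hb]

/-- Replacement of the `p`-th column by a combination of all columns, with coefficients depending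
on the row. -/
def colOp (D : Matrix (Fin n) (Fin n) F) (p : Fin n) :
    Matrix (Fin n) (Fin n) F →ₗ[F] Matrix (Fin n) (Fin n) F where
  toFun M := M.updateCol p fun k => (D k p)⁻¹ * ∑ l, D k l * M k l
  map_add' M N := by
    ext a b
    by_cases h : b = p
    · subst h
      simp [mul_add, sum_add_distrib]
    · simp [Matrix.updateCol_ne h]
  map_smul' c M := by
    ext a b
    by_cases h : b = p
    · subst h
      simp only [Matrix.updateCol_self, Matrix.smul_apply, smul_eq_mul, RingHom.id_apply,
        mul_left_comm _ c, ← mul_sum]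
    · simp [Matrix.updateCol_ne h]

theorem colOp_apply (D : Matrix (Fin n) (Fin n) F) (p : Fin n) (M : Matrix (Fin n) (Fin n) F) :
    colOp D p M = M.updateCol p fun k => (D k p)⁻¹ * ∑ l, D k l * M k l := rfl

theorem colOp_self (D : Matrix (Fin n) (Fin n) F) (p : Fin n) (M : Matrix (Fin n) (Fin n) F)
    (k : Fin n) : colOp D p M k p = (D k p)⁻¹ * ∑ l, D k l * M k l := by
  rw [colOp_apply, Matrix.updateCol_self]

theorem colOp_ne (D : Matrix (Fin n) (Fin n) F) {p l : Fin n} (h : l ≠ p)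
    (M : Matrix (Fin n) (Fin n) F) (k : Fin n) : colOp D p M k l = M k l := by
  rw [colOp_apply, Matrix.updateCol_ne h]

theorem colOp_row_eq_zero_iff {D : Matrix (Fin n) (Fin n) F} {p : Fin n} (hp : ∀ k, D k p ≠ 0)
    {M : Matrix (Fin n) (Fin n) F} {k : Fin n} :
    (∀ l, colOp D p M k l = 0) ↔ ∀ l, M k l = 0 := by
  constructor
  · intro h
    have h0 : ∀ l ≠ p, M k l = 0 := fun l hl => by rw [← colOp_ne D hl M k, h]
    intro l
    by_cases hl : l = p
    · have := h p
      rw [colOp_self, sum_eq_single p (fun b _ hb => by rw [h0 b hb, mul_zero]) (by simp),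
        inv_mul_cancel_left₀ (hp k)] at this
      rwa [hl]
    · exact h0 l hl
  · intro h l
    by_cases hl : l = p
    · rw [hl, colOp_self]
      simp [h]
    · rw [colOp_ne D hl, h]

/-- Subtracting the new column `p` from the old one gives an element of `B`, hence a zero; linearity
in column `p` concludes. -/
theorem schur_colOp {g : Equiv.Perm (Fin n) → Fˣ} {B : Submodule F (Matrix (Fin n) (Fin n) F)}
    (hB : Vanishes g B) {D : Matrix (Fin n) (Fin n) F} {p : Fin n} (hp : ∀ k, D k p ≠ 0)
    (hD : ∀ M, M ∈ B ↔ ∀ k, ∑ l, D k l * M k l = 0) (M : Matrix (Fin n) (Fin n) F) :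
    schur g (colOp D p M) = schur g M := by
  set y : Fin n → F := fun k => (D k p)⁻¹ * ∑ l, D k l * M k l with hy
  have h : M + colLin p (-y) ∈ B := by
    rw [hD]
    intro k
    simp only [Matrix.add_apply, mul_add, sum_add_distrib, colLin_apply]
    simp [hy, mul_inv_cancel_left₀ (hp k)]
  have h' := hB _ h
  rw [schur_add_colLin, map_neg] at h'
  rw [colOp_apply, ← schurCol_apply, ← hy]
  linear_combination -h'

/-- The set `Q` holds the columns already straightened. A matrix outside `B` vanishing on those
columns forces a usable pivot `p` outside `Q`, so earlier columns are not disturbed. -/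
theorem exists_colOp {g : Equiv.Perm (Fin n) → Fˣ} {B : Submodule F (Matrix (Fin n) (Fin n) F)}
    (hB : Vanishes g B) (hc : IsColType B) (Q : Set (Fin n))
    (hQ : ∃ M, (∀ q ∈ Q, M ∈ colZero F q) ∧ M ∉ B) :
    ∃ p ∉ Q, ∃ e : Matrix (Fin n) (Fin n) F ≃ₗ[F] Matrix (Fin n) (Fin n) F,
      (∀ M, schur g (e M) = schur g M) ∧ (∀ M, e M ∈ colZero F p ↔ M ∈ B) ∧
      (∀ q ≠ p, ∀ M, e M ∈ colZero F q ↔ M ∈ colZero F q) ∧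
      ∀ i M, e M ∈ rowZero F i ↔ M ∈ rowZero F i := by
  obtain ⟨D, hD0, -, hD⟩ := hc
  obtain ⟨M₀, hM₀, hMB⟩ := hQ
  obtain ⟨p, hpQ, hp⟩ : ∃ p ∉ Q, ∀ k, D k p ≠ 0 := by
    by_contra! hcon
    refine hMB ((hD M₀).mpr fun k => sum_eq_zero fun l _ => ?_)
    by_cases hl : l ∈ Q
    · rw [mem_colZero.mp (hM₀ l hl), mul_zero]
    · obtain ⟨k', hk'⟩ := hcon l hl
      rw [(hD0 l).resolve_right (fun h => h k' hk'), zero_mul]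
  have hinj : Function.Injective (colOp D p) := by
    rw [injective_iff_map_eq_zero]
    intro M hM
    ext k l
    exact (colOp_row_eq_zero_iff hp).mp (fun l => congrFun (congrFun hM k) l) l
  refine ⟨p, hpQ, LinearEquiv.ofInjectiveEndo _ hinj, schur_colOp hB hp hD, fun M => ?_,
    fun q hq M => ?_, fun i M => colOp_row_eq_zero_iff hp⟩
  · rw [hD]
    refine forall_congr' fun k => ?_
    rw [LinearEquiv.coe_ofInjectiveEndo, colOp_self, mul_eq_zero]
    simp [hp k]
  · refine forall_congr' fun k => ?_
    rw [LinearEquiv.coe_ofInjectiveEndo, colOp_ne D hq]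

theorem exists_rowOp {g : Equiv.Perm (Fin n) → Fˣ} {B : Submodule F (Matrix (Fin n) (Fin n) F)}
    (hB : Vanishes g B) (hc : IsColType (transposeSub B)) (Q : Set (Fin n))
    (hQ : ∃ M, (∀ q ∈ Q, M ∈ rowZero F q) ∧ M ∉ B) :
    ∃ p ∉ Q, ∃ e : Matrix (Fin n) (Fin n) F ≃ₗ[F] Matrix (Fin n) (Fin n) F,
      (∀ M, schur g (e M) = schur g M) ∧ (∀ M, e M ∈ rowZero F p ↔ M ∈ B) ∧
      (∀ q ≠ p, ∀ M, e M ∈ rowZero F q ↔ M ∈ rowZero F q) ∧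
      ∀ j M, e M ∈ colZero F j ↔ M ∈ colZero F j := by
  obtain ⟨M₀, hM₀, hMB⟩ := hQ
  obtain ⟨p, hp, e, h1, h2, h3, h4⟩ := exists_colOp hB.transposeSub hc Q
    ⟨M₀.transpose, hM₀, hMB⟩
  let t := Matrix.transposeLinearEquiv (Fin n) (Fin n) F F
  refine ⟨p, hp, (t.trans e).trans t, fun M => ?_, fun M => ?_, fun q hq M => ?_, fun j M => ?_⟩
  · change schur g (e M.transpose).transpose = _
    rw [← schur_transpose', h1, schur_transpose]
  · exact h2 M.transpose
  · exact h3 q hq M.transpose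
  · exact h4 j M.transpose

/-! ### Straightening a bijection that preserves zeros -/

/-- `W` maps the zero set of one Schur functional onto that of another one. -/
def PreservesZeros (f g : Equiv.Perm (Fin n) → Fˣ)
    (W : Matrix (Fin n) (Fin n) F ≃ₗ[F] Matrix (Fin n) (Fin n) F) : Prop :=
  ∀ M, schur g (W M) = 0 ↔ schur f M = 0

theorem PreservesZeros.trans {f g : Equiv.Perm (Fin n) → Fˣ}
    {W e : Matrix (Fin n) (Fin n) F ≃ₗ[F] Matrix (Fin n) (Fin n) F} (hW : PreservesZeros f g W)
    (he : ∀ M, schur g (e M) = schur g M) : PreservesZeros f g (W.trans e) := fun M => by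
  rw [LinearEquiv.trans_apply, he, hW]

theorem PreservesZeros.vanishes_map {f g : Equiv.Perm (Fin n) → Fˣ}
    {W : Matrix (Fin n) (Fin n) F ≃ₗ[F] Matrix (Fin n) (Fin n) F} (hW : PreservesZeros f g W)
    {A : Submodule F (Matrix (Fin n) (Fin n) F)} (hA : Vanishes f A) :
    Vanishes g (A.map W.toLinearMap) := by
  rintro _ ⟨M, hM, rfl⟩
  exact (hW M).mpr (hA M hM)

theorem PreservesZeros.isColType_or (hn : 2 ≤ n) {f g : Equiv.Perm (Fin n) → Fˣ}
    {W : Matrix (Fin n) (Fin n) F ≃ₗ[F] Matrix (Fin n) (Fin n) F} (hW : PreservesZeros f g W)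
    {A : Submodule F (Matrix (Fin n) (Fin n) F)} (hA : Vanishes f A)
    (hdim : finrank F A + n = n * n) :
    IsColType (A.map W.toLinearMap) ∨ IsColType (transposeSub (A.map W.toLinearMap)) :=
  (hW.vanishes_map hA).isColType_or hn (by rwa [LinearEquiv.finrank_map_eq])

theorem apply_mem_map_iff (W : Matrix (Fin n) (Fin n) F ≃ₗ[F] Matrix (Fin n) (Fin n) F)
    (A : Submodule F (Matrix (Fin n) (Fin n) F)) (M : Matrix (Fin n) (Fin n) F) :
    W M ∈ A.map W.toLinearMap ↔ M ∈ A := by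
  constructor
  · rintro ⟨N, hN, h⟩
    rwa [← W.injective h]
  · exact fun h => ⟨M, h, rfl⟩

theorem exists_apply_ne_zero (W : Matrix (Fin n) (Fin n) F ≃ₗ[F] Matrix (Fin n) (Fin n) F)
    (p q : Fin n) : ∃ M, W M p q ≠ 0 := by
  refine ⟨W.symm (colLin q (Pi.single p 1)), ?_⟩
  simp [colLin_apply]

theorem colLin_one_mem_colZero_iff {j l : Fin n} :
    colLin j (1 : Fin n → F) ∈ colZero F l ↔ l ≠ j := by
  rw [mem_colZero]
  constructor
  · rintro h rfl
    simpa [colLin_apply] using h l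
  · intro h i
    simp [colLin_apply, h]

theorem rowLin_one_mem_rowZero_iff {j l : Fin n} :
    (colLin j (1 : Fin n → F)).transpose ∈ rowZero F l ↔ l ≠ j :=
  colLin_one_mem_colZero_iff

theorem PreservesZeros.exists_columns (hn : 2 ≤ n) {f g : Equiv.Perm (Fin n) → Fˣ}
    {W : Matrix (Fin n) (Fin n) F ≃ₗ[F] Matrix (Fin n) (Fin n) F} (hW : PreservesZeros f g W)
    {j₀ : Fin n} (h₀ : IsColType ((colZero F j₀).map W.toLinearMap)) (s : Finset (Fin n)) :
    ∃ (e : Matrix (Fin n) (Fin n) F ≃ₗ[F] Matrix (Fin n) (Fin n) F) (π : Fin n → Fin n),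
      (∀ M, schur g (e M) = schur g M) ∧
      ∀ j ∈ insert j₀ s, ∀ M, e (W M) ∈ colZero F (π j) ↔ M ∈ colZero F j := by
  induction s using Finset.induction_on with
  | empty =>
    obtain ⟨p, -, e, h1, h2, -, -⟩ := exists_colOp (hW.vanishes_map (vanishes_colZero f j₀)) h₀ ∅
      ⟨W (colLin j₀ 1), by simp, by rw [apply_mem_map_iff, colLin_one_mem_colZero_iff]; simp⟩
    refine ⟨e, fun _ => p, h1, fun j hj M => ?_⟩
    rw [insert_empty_eq, mem_singleton] at hj
    rw [h2, apply_mem_map_iff, hj]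
  | insert j s _ ih =>
    obtain ⟨e, π, h1, h2⟩ := ih
    by_cases hjs : j ∈ insert j₀ s
    · exact ⟨e, π, h1, by rwa [insert_comm, insert_eq_of_mem hjs]⟩
    have hjj : j ≠ j₀ := fun h => hjs (h ▸ mem_insert_self _ _)
    have hW' := hW.trans h1
    have hvan := hW'.vanishes_map (vanishes_colZero f j)
    rcases hW'.isColType_or hn (vanishes_colZero f j) (finrank_colZero j) with hc | hr
    · obtain ⟨p, hp, e', h1', h2', h3', -⟩ := exists_colOp hvan hc (π '' (insert j₀ s : Finset _))
        ⟨W.trans e (colLin j 1), by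
          rintro _ ⟨l, hl, rfl⟩
          rw [LinearEquiv.trans_apply, h2 l hl, colLin_one_mem_colZero_iff]
          rintro rfl
          exact hjs hl, by
          rw [apply_mem_map_iff, colLin_one_mem_colZero_iff]; simp⟩
      refine ⟨e.trans e', Function.update π j p, fun M => ?_, fun l hl M => ?_⟩
      · rw [LinearEquiv.trans_apply, h1', h1]
      · by_cases hlj : l = j
        · rw [hlj, Function.update_self, LinearEquiv.trans_apply, h2',
            show e (W M) = W.trans e M from rfl, apply_mem_map_iff]
        · have hl' : l ∈ insert j₀ s := by
            rw [insert_comm, mem_insert] at hl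
            exact hl.resolve_left hlj
          rw [Function.update_of_ne hlj, LinearEquiv.trans_apply,
            h3' _ (fun h => hp ⟨l, hl', h⟩), h2 l hl']
    -- Row type is impossible: any matrix splits into one with zero column `j` and one with zero
    -- column `j₀`, so entry `(p, π j₀)` would vanish on the whole image.
    · exfalso
      obtain ⟨p, -, e', -, h2', -, h4'⟩ := exists_rowOp hvan hr ∅
        ⟨W.trans e (colLin j 1), by simp, by
          rw [apply_mem_map_iff, colLin_one_mem_colZero_iff]; simp⟩
      obtain ⟨M, hM⟩ := exists_apply_ne_zero ((W.trans e).trans e') p (π j₀)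
      obtain ⟨M₁, hM₁, M₂, hM₂, rfl⟩ := colZero_add_colZero hjj M
      have e1 : (W.trans e).trans e' M₁ ∈ rowZero F p := by
        rw [LinearEquiv.trans_apply, h2', apply_mem_map_iff]; exact hM₁
      have e2 : (W.trans e).trans e' M₂ ∈ colZero F (π j₀) := by
        rw [LinearEquiv.trans_apply, h4', LinearEquiv.trans_apply, h2 j₀ (mem_insert_self _ _)]
        exact hM₂
      rw [map_add, Matrix.add_apply, mem_rowZero.mp e1, mem_colZero.mp e2, add_zero] at hM
      exact hM rfl

theorem PreservesZeros.exists_rows (hn : 2 ≤ n) {f g : Equiv.Perm (Fin n) → Fˣ}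
    {W : Matrix (Fin n) (Fin n) F ≃ₗ[F] Matrix (Fin n) (Fin n) F} (hW : PreservesZeros f g W)
    {π : Fin n → Fin n} (hπ : ∀ j M, W M ∈ colZero F (π j) ↔ M ∈ colZero F j)
    (s : Finset (Fin n)) :
    ∃ (e : Matrix (Fin n) (Fin n) F ≃ₗ[F] Matrix (Fin n) (Fin n) F) (ρ : Fin n → Fin n),
      (∀ M, schur g (e M) = schur g M) ∧
      (∀ j M, e (W M) ∈ colZero F (π j) ↔ M ∈ colZero F j) ∧
      ∀ i ∈ s, ∀ M, e (W M) ∈ rowZero F (ρ i) ↔ M ∈ rowZero F i := by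
  induction s using Finset.induction_on with
  | empty => exact ⟨LinearEquiv.refl _ _, id, fun _ => rfl, hπ, by simp⟩
  | insert i s his ih =>
    obtain ⟨e, ρ, h1, hcol, h2⟩ := ih
    have hW' := hW.trans h1
    have hvan := hW'.vanishes_map (vanishes_rowZero f i)
    rcases hW'.isColType_or hn (vanishes_rowZero f i) (finrank_rowZero i) with hc | hr
    -- Column type is impossible: pulling back a splitting along the columns `π j ≠ p` writes every
    -- matrix as one with zero row `i` plus one with zero column `j`, so entry `(i, j)` would always
    -- vanish.
    · exfalso
      obtain ⟨p, -, e', -, h2', h3', -⟩ := exists_colOp hvan hc ∅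
        ⟨W.trans e (colLin i 1).transpose, by simp, by
          rw [apply_mem_map_iff, rowLin_one_mem_rowZero_iff]; simp⟩
      obtain ⟨j, hj⟩ : ∃ j, π j ≠ p := by
        by_contra! hcon
        have h01 : (⟨0, by omega⟩ : Fin n) ≠ ⟨1, by omega⟩ := by simp
        have := (hπ ⟨0, by omega⟩ (colLin ⟨1, by omega⟩ 1)).mpr
          (colLin_one_mem_colZero_iff.mpr h01)
        rw [hcon, ← hcon ⟨1, by omega⟩, hπ, colLin_one_mem_colZero_iff] at this
        exact this rfl
      let T := (W.trans e).trans e'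
      obtain ⟨M₁, hM₁, M₂, hM₂, hM⟩ := colZero_add_colZero hj
        (T (colLin j (Pi.single i 1)))
      have e1 : T.symm M₂ ∈ rowZero F i := by
        rw [← apply_mem_map_iff (W.trans e), ← h2', ← LinearEquiv.trans_apply,
          LinearEquiv.apply_symm_apply]
        exact hM₂
      have e2 : T.symm M₁ ∈ colZero F j := by
        rw [← hcol, ← h3' _ hj, show e' (e (W (T.symm M₁))) = M₁ from T.apply_symm_apply M₁]
        exact hM₁
      have h := congrArg T.symm hM
      rw [LinearEquiv.symm_apply_apply, map_add] at h
      have h' := congrFun (congrFun h i) j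
      rw [Matrix.add_apply, mem_rowZero.mp e1, mem_colZero.mp e2] at h'
      simp [colLin_apply] at h'
    · obtain ⟨p, hp, e', h1', h2', h3', h4'⟩ := exists_rowOp hvan hr (ρ '' s)
        ⟨W.trans e (colLin i 1).transpose, by
          rintro _ ⟨l, hl, rfl⟩
          rw [LinearEquiv.trans_apply, h2 l hl, rowLin_one_mem_rowZero_iff]
          rintro rfl
          exact his hl, by
          rw [apply_mem_map_iff, rowLin_one_mem_rowZero_iff]; simp⟩
      refine ⟨e.trans e', Function.update ρ i p, fun M => ?_, fun j M => ?_, fun l hl M => ?_⟩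
      · rw [LinearEquiv.trans_apply, h1', h1]
      · rw [LinearEquiv.trans_apply, h4', hcol]
      · by_cases hli : l = i
        · rw [hli, Function.update_self, LinearEquiv.trans_apply, h2',
            show e (W M) = W.trans e M from rfl, apply_mem_map_iff]
        · have hl' : l ∈ s := (mem_insert.mp hl).resolve_left hli
          rw [Function.update_of_ne hli, LinearEquiv.trans_apply,
            h3' _ (fun h => hp ⟨l, hl', h⟩), h2 l hl']

/-- A linear bijection that permutes the zero columns and the zero rows acts entrywise. -/
theorem exists_entrywise {W : Matrix (Fin n) (Fin n) F ≃ₗ[F] Matrix (Fin n) (Fin n) F}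
    {π ρ : Fin n → Fin n} (hπ : ∀ j M, W M ∈ colZero F (π j) ↔ M ∈ colZero F j)
    (hρ : ∀ i M, W M ∈ rowZero F (ρ i) ↔ M ∈ rowZero F i) :
    ∃ (A : Matrix (Fin n) (Fin n) Fˣ) (τ τ' : Equiv.Perm (Fin n)),
      ∀ M i j, W M (τ i) (τ' j) = A (τ i) (τ' j) * M i j := by
  have hπi : Function.Injective π := by
    intro j l h
    by_contra hne
    have := (hπ j (colLin l 1)).mpr (colLin_one_mem_colZero_iff.mpr hne)
    rw [h, hπ, colLin_one_mem_colZero_iff] at this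
    exact this rfl
  have hρi : Function.Injective ρ := by
    intro j l h
    by_contra hne
    have := (hρ j (colLin l 1).transpose).mpr (rowLin_one_mem_rowZero_iff.mpr hne)
    rw [h, hρ, rowLin_one_mem_rowZero_iff] at this
    exact this rfl
  -- Modulo matrices with zero row `i` and matrices with zero column `j`, only the entry `(i, j)`
  -- survives.
  have key : ∀ M i j, W M (ρ i) (π j) = W (colLin j (Pi.single i 1)) (ρ i) (π j) * M i j := by
    intro M i j
    obtain ⟨M₁, hM₁, M₂, hM₂, hM⟩ := exists_single_add i j M
    conv_lhs => rw [hM]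
    rw [map_add, map_add, map_smul, Matrix.add_apply, Matrix.add_apply, Matrix.smul_apply,
      mem_rowZero.mp ((hρ i M₁).mpr hM₁), mem_colZero.mp ((hπ j M₂).mpr hM₂), smul_eq_mul]
    ring
  have hne : ∀ i j, W (colLin j (Pi.single i 1)) (ρ i) (π j) ≠ 0 := by
    intro i j h
    obtain ⟨M, hM⟩ := exists_apply_ne_zero W (ρ i) (π j)
    rw [key, h, zero_mul] at hM
    exact hM rfl
  let τ := Equiv.ofBijective ρ (Finite.injective_iff_bijective.mp hρi)
  let τ' := Equiv.ofBijective π (Finite.injective_iff_bijective.mp hπi)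
  refine ⟨fun i j => Units.mk0 _ (hne (τ.symm i) (τ'.symm j)), τ, τ', fun M i j => ?_⟩
  simp only [Units.val_mk0, Equiv.symm_apply_apply]
  exact key M i j

/-! ### Proportionality and PH-equivalence -/

theorem schur_phAct (g : Equiv.Perm (Fin n) → Fˣ) (A : Matrix (Fin n) (Fin n) Fˣ)
    (τ τ' : Equiv.Perm (Fin n)) {M N : Matrix (Fin n) (Fin n) F}
    (h : ∀ i j, N (τ i) (τ' j) = A (τ i) (τ' j) * M i j) :
    schur g N = schur (phAct g A τ τ') M := by
  unfold schur phAct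
  symm
  refine Fintype.sum_equiv ((Equiv.mulLeft τ).trans (Equiv.mulRight τ'⁻¹)) _ _ fun σ => ?_
  simp only [Equiv.trans_apply, Equiv.coe_mulLeft, Equiv.coe_mulRight, Units.val_mul,
    Units.coe_prod]
  rw [mul_assoc]
  congr 1
  rw [← Equiv.prod_comp τ' fun k => ((A ((τ * σ * τ'⁻¹) k) k : Fˣ) : F), ← prod_mul_distrib,
    ← Equiv.prod_comp τ' fun k => N ((τ * σ * τ'⁻¹) k) k]
  refine prod_congr rfl fun j _ => ?_
  simp [h]

/-- Transpositions generate the group, so it suffices that `h / f` agrees at `σ` and `σ * swap j l`.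
A matrix on which only these two permutations contribute, tuned to be a zero for `f`, gives this
equality. -/
theorem exists_proportional {f h : Equiv.Perm (Fin n) → Fˣ}
    (hfh : ∀ M : Matrix (Fin n) (Fin n) F, schur h M = 0 ↔ schur f M = 0) :
    ∃ α : Fˣ, ∀ σ, h σ = α * f σ := by
  refine ⟨h 1 * (f 1)⁻¹, fun σ => ?_⟩
  rw [← div_eq_iff_eq_mul, ← div_eq_mul_inv]
  induction σ using Equiv.Perm.swap_induction_on' with
  | one => rfl
  | mul_swap σ j l hjl ih =>
    rw [← ih, div_eq_div_iff_mul_eq_mul]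
    let y : Fin n → F := Pi.single (σ j) (-(f (σ * Equiv.swap j l) : F)) + Pi.single (σ l) (f σ : F)
    have hne : σ j ≠ σ l := fun h => hjl (σ.injective h)
    have hy : ∀ u : Equiv.Perm (Fin n) → Fˣ, schur u (((permMat σ : Matrix (Fin n) (Fin n) F).updateCol j 0 +
        colLin l (Pi.single (σ j) 1)).updateCol j y) =
        u σ * -(f (σ * Equiv.swap j l) : F) + u (σ * Equiv.swap j l) * f σ := by
      intro u
      rw [← schurCol_apply, schurCol_permMat_add u σ hjl.symm, schur_permMat_swap u σ hjl.symm]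
      simp [y, hne, hne.symm]
    have := (hfh _).mpr ((hy f).trans (by ring))
    rw [hy] at this
    ext
    push_cast
    linear_combination this

theorem phAct_smul (hn : 0 < n) {f g : Equiv.Perm (Fin n) → Fˣ} {A : Matrix (Fin n) (Fin n) Fˣ}
    {τ τ' : Equiv.Perm (Fin n)} {α : Fˣ} (h : ∀ σ, phAct g A τ τ' σ = α * f σ) : PHEquiv g f := by
  -- The scalar is absorbed into column `0`, which every permutation meets exactly once.
  refine ⟨fun i k => if k = ⟨0, hn⟩ then α⁻¹ * A i k else A i k, τ, τ', funext fun σ => ?_⟩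
  have hp : ∀ ρ : Equiv.Perm (Fin n),
      ∏ k, (if k = ⟨0, hn⟩ then α⁻¹ * A (ρ k) k else A (ρ k) k) = α⁻¹ * ∏ k, A (ρ k) k := by
    intro ρ
    rw [← mul_prod_erase univ _ (mem_univ ⟨0, hn⟩),
      ← mul_prod_erase univ (fun k => A (ρ k) k) (mem_univ ⟨0, hn⟩), if_pos rfl, mul_assoc]
    congr 2
    exact prod_congr rfl fun k hk => if_neg (ne_of_mem_erase hk)
  have h' := h σ
  simp only [phAct] at h' ⊢
  rw [hp, mul_left_comm, h', inv_mul_cancel_left]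

theorem PreservesZeros.of_isColType (hn : 2 ≤ n) {f g : Equiv.Perm (Fin n) → Fˣ}
    {W : Matrix (Fin n) (Fin n) F ≃ₗ[F] Matrix (Fin n) (Fin n) F} (hW : PreservesZeros f g W)
    {j₀ : Fin n} (h₀ : IsColType ((colZero F j₀).map W.toLinearMap)) :
    PHEquiv g f ∧ ∃ α : Fˣ, ∀ M, schur g (W M) = α * schur f M := by
  obtain ⟨e, π, h1, h2⟩ := hW.exists_columns hn h₀ univ
  obtain ⟨e', ρ, h1', h2', h3'⟩ := (hW.trans h1).exists_rows hn (π := π)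
    (fun j M => h2 j (by simp) M) univ
  obtain ⟨A, τ, τ', hA⟩ := exists_entrywise (W := (W.trans e).trans e') h2'
    (fun i M => h3' i (mem_univ i) M)
  have hg : ∀ M, schur g (W M) = schur (phAct g A τ τ') M := fun M => by
    rw [← schur_phAct g A τ τ' (hA M), LinearEquiv.trans_apply, h1', LinearEquiv.trans_apply, h1]
  obtain ⟨α, hα⟩ := exists_proportional (f := f) (h := phAct g A τ τ') fun M => by
    rw [← hg, hW]
  refine ⟨phAct_smul (by omega) hα, α, fun M => ?_⟩
  rw [hg, schur, schur, mul_sum]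
  refine sum_congr rfl fun σ _ => ?_
  rw [hα, Units.val_mul, mul_assoc]

theorem PHEquiv.transpose {f g : Equiv.Perm (Fin n) → Fˣ} (h : PHEquiv f g) :
    PHEquiv (transpose f) (transpose g) := by
  obtain ⟨A, τ, τ', rfl⟩ := h
  refine ⟨A.transpose, τ', τ, funext fun σ => ?_⟩
  simp only [phAct, SchurFunctional.transpose]
  rw [show (τ' * σ * τ⁻¹)⁻¹ = τ * σ⁻¹ * τ'⁻¹ by group]
  congr 1
  exact Fintype.prod_equiv (τ' * σ * τ⁻¹) _ _ fun j => by simp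

theorem PreservesZeros.phEquiv (hn : 2 ≤ n) {f g : Equiv.Perm (Fin n) → Fˣ}
    {W : Matrix (Fin n) (Fin n) F ≃ₗ[F] Matrix (Fin n) (Fin n) F} (hW : PreservesZeros f g W) :
    (PHEquiv g f ∨ PHEquiv g (transpose f)) ∧ ∃ α : Fˣ, ∀ M, schur g (W M) = α * schur f M := by
  have j₀ : Fin n := ⟨0, by omega⟩
  rcases hW.isColType_or hn (vanishes_colZero f j₀) (finrank_colZero j₀) with hc | hr
  · obtain ⟨h1, h2⟩ := hW.of_isColType hn hc
    exact ⟨Or.inl h1, h2⟩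
  · let t := Matrix.transposeLinearEquiv (Fin n) (Fin n) F F
    have ht : ∀ M, schur (transpose g) (W.trans t M) = schur g (W M) := fun M =>
      schur_transpose g (W M)
    have hW' : PreservesZeros f (transpose g) (W.trans t) := fun M => by rw [ht, hW]
    have hmap : (colZero F j₀).map (W.trans t).toLinearMap =
        transposeSub ((colZero F j₀).map W.toLinearMap) := by
      ext M
      rw [← (W.trans t).apply_symm_apply M, apply_mem_map_iff, mem_transposeSub]
      exact (apply_mem_map_iff W _ _).symm
    obtain ⟨h1, α, hα⟩ := hW'.of_isColType hn (j₀ := j₀) (hmap ▸ hr)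
    refine ⟨Or.inr ?_, α, fun M => by rw [← ht, hα]⟩
    have := h1.transpose
    rwa [transpose_transpose] at this

/-- Adding an element `N` of the kernel must preserve zeros. Adding it to a suitable matrix with
zero column `j` makes the functional a nonzero multiple of `N i j`. -/
theorem injective_of_preserves {f g : Equiv.Perm (Fin n) → Fˣ}
    {U : Matrix (Fin n) (Fin n) F →ₗ[F] Matrix (Fin n) (Fin n) F}
    (hU : ∀ M, schur g (U M) = 0 ↔ schur f M = 0) : Function.Injective U := by
  rw [injective_iff_map_eq_zero]
  intro N hN
  ext i j
  have h := (hU ((permMat (Equiv.swap j i) - N).updateCol j 0)).mpr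
    (schur_eq_zero_of_col f (j := j) (by simp))
  rw [← add_zero (U _), ← hN, ← map_add, hU,
    schur_of_forall_ne f (j := j) (σ := Equiv.swap j i)] at h
  · simpa using h
  · intro a l hl
    simp [Matrix.updateCol_ne hl, permMat]

/-! ### Invariance of the class sizes -/

theorem ColEquiv.of_phAct {g : Equiv.Perm (Fin n) → Fˣ} {A : Matrix (Fin n) (Fin n) Fˣ}
    {τ τ' : Equiv.Perm (Fin n)} {i j : Fin n} :
    ColEquiv g (τ' i) (τ' j) ↔ ColEquiv (phAct g A τ τ') i j := by
  unfold ColEquiv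
  rw [τ'.injective.eq_iff, Ne, τ'.injective.eq_iff]
  refine or_congr Iff.rfl (and_congr Iff.rfl ⟨?_, ?_⟩)
  · rintro ⟨Z, hZ⟩
    -- Rescaling entries by `A` multiplies the ratio of two columns by the ratio of the
    -- corresponding columns of `A`.
    refine ⟨fun k => Z (τ k) * A (τ k) (τ' i) * (A (τ k) (τ' j))⁻¹, fun M hM => ?_⟩
    rw [← schur_phAct g A τ τ'
      (N := fun a b => A a b * M (τ.symm a) (τ'.symm b)) (by simp)]
    refine hZ _ fun k => ?_
    obtain ⟨k, rfl⟩ := τ.surjective k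
    simp only [Equiv.symm_apply_apply, hM, Units.val_mul, Units.val_inv_eq_inv_val]
    field_simp
  · rintro ⟨Z, hZ⟩
    refine ⟨fun k => Z (τ.symm k) * (A k (τ' i))⁻¹ * A k (τ' j), fun N hN => ?_⟩
    rw [schur_phAct g A τ τ'
      (M := fun a b => ((A (τ a) (τ' b))⁻¹ : Fˣ) * N (τ a) (τ' b)) (by simp)]
    refine hZ _ fun k => ?_
    simp only [Equiv.symm_apply_apply, hN, Units.val_mul, Units.val_inv_eq_inv_val]
    field_simp

theorem rowEquiv_iff_colEquiv_transpose {f : Equiv.Perm (Fin n) → Fˣ} :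
    RowEquiv f = ColEquiv (transpose f) := by
  funext i j
  refine propext (or_congr Iff.rfl (and_congr Iff.rfl (exists_congr fun Z => ?_)))
  constructor
  · intro h M hM
    rw [schur_transpose']
    exact h _ hM
  · intro h M hM
    rw [← schur_transpose]
    exact h _ hM

theorem cardList_congr {r r' : Fin n → Fin n → Prop} (π : Equiv.Perm (Fin n))
    (h : ∀ i j, r' (π i) (π j) ↔ r i j) : cardList r' = cardList r := by
  have hcls : ∀ i, relClass r' (π i) = (relClass r i).map π.toEmbedding := by
    intro i
    ext j
    obtain ⟨j, rfl⟩ := π.surjective j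
    simp [relClass, h]
  have himg : univ.image (relClass r') =
      (univ.image (relClass r)).map ⟨_, Finset.map_injective π.toEmbedding⟩ := by
    ext S
    simp only [mem_image, mem_univ, true_and, mem_map, Function.Embedding.coeFn_mk,
      exists_exists_eq_and]
    constructor
    · rintro ⟨i, rfl⟩
      obtain ⟨i, rfl⟩ := π.surjective i
      exact ⟨i, (hcls i).symm⟩
    · rintro ⟨i, rfl⟩
      exact ⟨π i, hcls i⟩
  rw [cardList, himg, Finset.map_val, Multiset.map_map]
  simp [cardList, Function.comp_def]

theorem PHEquiv.colList_eq {f g : Equiv.Perm (Fin n) → Fˣ} (h : PHEquiv g f) :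
    colList g = colList f := by
  obtain ⟨A, τ, τ', rfl⟩ := h
  exact cardList_congr τ' fun _ _ => ColEquiv.of_phAct

theorem rowList_eq_colList_transpose (f : Equiv.Perm (Fin n) → Fˣ) :
    rowList f = colList (transpose f) := by
  rw [rowList, colList, rowEquiv_iff_colEquiv_transpose]

theorem PHEquiv.rowList_eq {f g : Equiv.Perm (Fin n) → Fˣ} (h : PHEquiv g f) :
    rowList g = rowList f := by
  rw [rowList_eq_colList_transpose, rowList_eq_colList_transpose, h.transpose.colList_eq]

/-! ### Existence of transformations, and sizes at most one -/

theorem PHEquiv.exists_isTransformation {f g : Equiv.Perm (Fin n) → Fˣ} (h : PHEquiv g f) :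
    ∃ U : Matrix (Fin n) (Fin n) F →ₗ[F] Matrix (Fin n) (Fin n) F, IsTransformation f g U := by
  obtain ⟨A, τ, τ', rfl⟩ := h
  refine ⟨{ toFun := fun M => Matrix.of fun a b => (A a b : F) * M (τ.symm a) (τ'.symm b)
            map_add' := fun M N => by ext; simp [mul_add]
            map_smul' := fun c M => by ext; simp [mul_left_comm] }, fun M => ?_⟩
  exact schur_phAct g A τ τ' (by simp)

theorem IsTransformation.phEquiv_of_le_one (hn : n ≤ 1) {f g : Equiv.Perm (Fin n) → Fˣ}
    {U : Matrix (Fin n) (Fin n) F →ₗ[F] Matrix (Fin n) (Fin n) F} (h : IsTransformation f g U) :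
    PHEquiv g f := by
  have hs : Subsingleton (Fin n) := Fin.subsingleton_iff_le_one.mpr hn
  rcases Nat.le_one_iff_eq_zero_or_eq_one.mp hn with rfl | rfl
  · refine ⟨fun _ _ => 1, 1, 1, funext fun σ => ?_⟩
    -- For `n = 0` the functional is the constant value of `f`, so the maps coincide.
    have h0 := h 0
    simp only [schur, univ_unique, sum_singleton, univ_eq_empty, prod_empty, mul_one] at h0
    ext
    simp only [phAct, univ_eq_empty, prod_empty, mul_one]
    rw [Subsingleton.elim (1 * σ * 1⁻¹) default, Subsingleton.elim σ default, h0]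
  · refine phAct_smul Nat.zero_lt_one (A := fun _ _ => 1) (τ := 1) (τ' := 1)
      (α := g 1 * (f 1)⁻¹) fun σ => ?_
    simp [phAct, Subsingleton.elim σ 1]

end SchurFunctional

end

theorem mainTheorem1 {F : Type*} [Field F] {n : ℕ} (f g : Equiv.Perm (Fin n) → Fˣ) :
    (2 ≤ n →
      ∀ U : Matrix (Fin n) (Fin n) F →ₗ[F] Matrix (Fin n) (Fin n) F,
        (∀ M : Matrix (Fin n) (Fin n) F,
          SchurFunctional.schur g (U M) = 0 ↔ SchurFunctional.schur f M = 0) →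
        Function.Bijective U ∧
        (SchurFunctional.PHEquiv g f ∨
          SchurFunctional.PHEquiv g (SchurFunctional.transpose f)) ∧
        ((SchurFunctional.rowList g, SchurFunctional.colList g) =
            (SchurFunctional.rowList f, SchurFunctional.colList f) ∨
          (SchurFunctional.rowList g, SchurFunctional.colList g) =
            (SchurFunctional.colList f, SchurFunctional.rowList f)) ∧
        ∃ α : Fˣ, SchurFunctional.IsTransformation (fun σ => α * f σ) g U) ∧
    ((∃ U : Matrix (Fin n) (Fin n) F →ₗ[F] Matrix (Fin n) (Fin n) F,
        SchurFunctional.IsTransformation f g U) ↔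
      (SchurFunctional.PHEquiv g f ∨
        SchurFunctional.PHEquiv g (SchurFunctional.transpose f))) := by
  open SchurFunctional in
  have main : 2 ≤ n → ∀ U : Matrix (Fin n) (Fin n) F →ₗ[F] Matrix (Fin n) (Fin n) F,
      (∀ M, schur g (U M) = 0 ↔ schur f M = 0) →
      Function.Injective U ∧ (PHEquiv g f ∨ PHEquiv g (transpose f)) ∧
        ∃ α : Fˣ, ∀ M, schur g (U M) = α * schur f M := fun hn U hU =>
    have hinj := injective_of_preserves hU
    ⟨hinj, PreservesZeros.phEquiv hn (W := LinearEquiv.ofInjectiveEndo U hinj) hU⟩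
  refine ⟨fun hn U hU => ?_, ?_, ?_⟩
  · obtain ⟨hinj, hph, α, hα⟩ := main hn U hU
    refine ⟨⟨hinj, LinearMap.injective_iff_surjective.mp hinj⟩, hph, ?_, α, fun M => ?_⟩
    · rcases hph with h | h
      · left
        rw [h.rowList_eq, h.colList_eq]
      · right
        rw [h.rowList_eq, h.colList_eq, SchurFunctional.rowList_eq_colList_transpose,
          SchurFunctional.rowList_eq_colList_transpose, SchurFunctional.transpose_transpose]
    · rw [hα, SchurFunctional.schur, SchurFunctional.schur, Finset.mul_sum]
      exact Finset.sum_congr rfl fun σ _ => by rw [Units.val_mul, mul_assoc]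
  · rintro ⟨U, hU⟩
    by_cases hn : 2 ≤ n
    · exact (main hn U fun M => by rw [hU M]).2.1
    · exact Or.inl (SchurFunctional.IsTransformation.phEquiv_of_le_one (by omega) hU)
  · rintro (h | h)
    · exact h.exists_isTransformation
    · obtain ⟨U, hU⟩ := h.exists_isTransformation
      refine ⟨U ∘ₗ (Matrix.transposeLinearEquiv (Fin n) (Fin n) F F).toLinearMap, fun M => ?_⟩
      exact (hU M.transpose).trans (SchurFunctional.schur_transpose f M)
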